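/- Call an $m \times n$ rectangle ($m,n$ positive integers) \emph{tileable} if it is the union of finitely many closed squares with sides parallel to those of the rectangle, each of integer side length at least $2$, whose interiors are pairwise disjoint. Then the following hold. (I) For every integer $n\ge 1$, the $2\times n$ and $4\times n$ rectangles (equivalently $n\times 2$ and $n\times 4$) are tileable if and only if $n$ is even. (II) For every integer $n\ge 1$, the $3\times n$ rectangle (equivalently $n\times 3$) is tileable if and only if $n\equiv 0 \pmod 3$. (III) For all integers $m\ge 5$ and $n\ge 20$, the $m\times n$ and $n\times m$ rectangles are tileable. (IV) For $2\le m,n\le 19$, the $m\times n$ rectangle is tileable if and only if $n\in R_m$, where - $R_2=R_4=\{2,4,6,8,10,12,14,16,18\}$; - $R_3=\{3,6,9,12,15,18\}$; - $R_5=\{5,6,10,11,12,15,16,17,18\}$; - $R_6=R_{12}=R_{18}=\{2,3,\dots,19\}$; - $R_7=\{6,7,10,12,13,14,16,17,18,19\}$; - $R_8=\{2,4,6,8,10,12,14,15,16,17,18,19\}$; - $R_9=\{3,6,9,10,12,13,14,15,16,17,18,19\}$; - $R_{10}=R_{16}=\{2,4,5,6,\dots,19\}$; - $R_{11}=\{5,6,10,11,12,\dots,19\}$;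 - $R_{13}=\{6,7,9,10,11,\dots,19\}$; - $R_{14}=\{2,4,6,7,8,\dots,19\}$; - $R_{15}=\{3,5,6,8,9,10,\dots,19\}$; - $R_{17}=\{5,6,7,\dots,19\}$; - $R_{19}=\{6,7,8,\dots,19\}$. Together, (I)–(IV) decide tileability for all $m,n\ge 2$. In particular, the $m\times n$ rectangle is tileable for all integers $m,n\ge 10$. -/

import Mathlib

/-- The closed axis-parallel rectangle `[x, x + w] × [y, y + h]` in the plane,
where `p = (x, y)` is its lower left corner. -/
def closedRect (p : ℝ × ℝ) (w h : ℝ) : Set (ℝ × ℝ) :=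
  Set.Icc p.1 (p.1 + w) ×ˢ Set.Icc p.2 (p.2 + h)

/-- The closed axis-parallel square of side `s` with lower left corner `p`. -/
def closedSquare (p : ℝ × ℝ) (s : ℝ) : Set (ℝ × ℝ) :=
  closedRect p s s

/-- The `m × n` rectangle can be tiled (exactly packed) by squares of integer side length at
least `2`: finitely many such squares, placed anywhere in the plane (the corners are real
points), have pairwise disjoint interiors, and their union is the rectangle. -/
def Tileable (m n : ℕ) : Prop :=
  ∃ (N : ℕ) (corner : Fin N → ℝ × ℝ) (side : Fin N → ℕ),
    (∀ i, 2 ≤ side i) ∧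
    (∀ i j, i ≠ j →
      Disjoint (interior (closedSquare (corner i) (side i)))
        (interior (closedSquare (corner j) (side j)))) ∧
    (⋃ i, closedSquare (corner i) (side i)) = closedRect (0, 0) m n

/-- The table of small cases: for `2 ≤ m ≤ 19`, `tableRow m` is the set of the `n` with
`2 ≤ n ≤ 19` whose entry in row `m` carries a check mark. -/
def tableRow : ℕ → Finset ℕ
  | 2 => {2, 4, 6, 8, 10, 12, 14, 16, 18}
  | 3 => {3, 6, 9, 12, 15, 18}
  | 4 => {2, 4, 6, 8, 10, 12, 14, 16, 18}
  | 5 => {5, 6, 10, 11, 12, 15, 16, 17, 18}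
  | 6 => {2, 3, 4, 5, 6, 7, 8, 9, 10, 11, 12, 13, 14, 15, 16, 17, 18, 19}
  | 7 => {6, 7, 10, 12, 13, 14, 16, 17, 18, 19}
  | 8 => {2, 4, 6, 8, 10, 12, 14, 15, 16, 17, 18, 19}
  | 9 => {3, 6, 9, 10, 12, 13, 14, 15, 16, 17, 18, 19}
  | 10 => {2, 4, 5, 6, 7, 8, 9, 10, 11, 12, 13, 14, 15, 16, 17, 18, 19}
  | 11 => {5, 6, 10, 11, 12, 13, 14, 15, 16, 17, 18, 19}
  | 12 => {2, 3, 4, 5, 6, 7, 8, 9, 10, 11, 12, 13, 14, 15, 16, 17, 18, 19}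
  | 13 => {6, 7, 9, 10, 11, 12, 13, 14, 15, 16, 17, 18, 19}
  | 14 => {2, 4, 6, 7, 8, 9, 10, 11, 12, 13, 14, 15, 16, 17, 18, 19}
  | 15 => {3, 5, 6, 8, 9, 10, 11, 12, 13, 14, 15, 16, 17, 18, 19}
  | 16 => {2, 4, 5, 6, 7, 8, 9, 10, 11, 12, 13, 14, 15, 16, 17, 18, 19}
  | 17 => {5, 6, 7, 8, 9, 10, 11, 12, 13, 14, 15, 16, 17, 18, 19}
  | 18 => {2, 3, 4, 5, 6, 7, 8, 9, 10, 11, 12, 13, 14, 15, 16, 17, 18, 19}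
  | 19 => {6, 7, 8, 9, 10, 11, 12, 13, 14, 15, 16, 17, 18, 19}
  | _ => ∅

/-- The block `[x, x + s) × [y, y + s)` of unit cells, coded as `(x, y, s)`, contains the
cell `(i, j)`. -/
def InBlock (q : ℕ × ℕ × ℕ) (i j : ℕ) : Prop :=
  (q.1 ≤ i ∧ i < q.1 + q.2.2) ∧ (q.2.1 ≤ j ∧ j < q.2.1 + q.2.2)

instance (q : ℕ × ℕ × ℕ) (i j : ℕ) : Decidable (InBlock q i j) := by
  unfold InBlock; infer_instance

/-- The `m × n` board of unit cells is partitioned by the blocks of `S`, all of side at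
least `2`. -/
def IsGridTiling (S : Finset (ℕ × ℕ × ℕ)) (m n : ℕ) : Prop :=
  (∀ q ∈ S, 2 ≤ q.2.2 ∧ q.1 + q.2.2 ≤ m ∧ q.2.1 + q.2.2 ≤ n) ∧
    ∀ i < m, ∀ j < n, ∃! q, q ∈ S ∧ InBlock q i j

/-- The `m × n` board of unit cells can be partitioned into square blocks of side at
least `2`. -/
def GridTileable (m n : ℕ) : Prop :=
  ∃ S, IsGridTiling S m n

/-! ### Real tilings and grid tilings -/

theorem interior_closedSquare (p : ℝ × ℝ) (s : ℝ) :
    interior (closedSquare p s) = Set.Ioo p.1 (p.1 + s) ×ˢ Set.Ioo p.2 (p.2 + s) := by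
  rw [closedSquare, closedRect, interior_prod_eq, interior_Icc, interior_Icc]

theorem mem_closedRect {p z : ℝ × ℝ} {w h : ℝ} :
    z ∈ closedRect p w h ↔ (p.1 ≤ z.1 ∧ z.1 ≤ p.1 + w) ∧ (p.2 ≤ z.2 ∧ z.2 ≤ p.2 + h) := by
  simp only [closedRect, Set.mem_prod, Set.mem_Icc]

/-- A shift in `(0, 1)` that moves no lattice point onto one of finitely many given numbers. -/
theorem exists_generic_offset {N : ℕ} (a : Fin N → ℝ) :
    ∃ x : ℝ, 0 < x ∧ x < 1 ∧ ∀ k (i : ℕ), a k ≠ i + x := by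
  obtain ⟨x, hx, hx'⟩ := ((Set.Ioo_infinite (zero_lt_one (α := ℝ))).sdiff
    (Set.finite_range fun k => Int.fract (a k))).nonempty
  refine ⟨x, hx.1, hx.2, fun k i h => hx' ⟨k, ?_⟩⟩
  simp only [h, Int.fract_natCast_add]
  exact Int.fract_eq_self.2 ⟨hx.1.le, hx.2⟩

/-- The points `i + x` in `[a, a + s)` are `s` consecutive ones, starting at `⌈a - x⌉₊`. Truncation
at zero is harmless because `a - x > -1`. -/
theorem ceil_offset_le_and_lt {a x : ℝ} {s i : ℕ} (ha : 0 ≤ a) (hx : x < 1) :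
    (⌈a - x⌉₊ ≤ i ∧ i < ⌈a - x⌉₊ + s) ↔ (a ≤ i + x ∧ i + x < a + s) := by
  rw [Nat.ceil_le, sub_le_iff_le_add]
  refine and_congr_right fun _ => ?_
  rcases lt_or_ge i s with h | h
  · have : (i : ℝ) + 1 ≤ s := by exact_mod_cast h
    exact iff_of_true (by omega) (by linarith)
  · rw [← tsub_lt_iff_right h, Nat.lt_ceil, Nat.cast_sub h]
    constructor <;> intro _ <;> linarith

theorem ceil_offset_add_le {a x : ℝ} {s m : ℕ} (hx : 0 < x) (ha : 0 ≤ a) (h : a + s ≤ m) :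
    ⌈a - x⌉₊ + s ≤ m := by
  have hs : s ≤ m := by exact_mod_cast (by linarith : (s : ℝ) ≤ m)
  have : ⌈a - x⌉₊ ≤ m - s := by
    rw [Nat.ceil_le, Nat.cast_sub hs]; linarith
  omega

theorem Tileable.gridTileable {m n : ℕ} (h : Tileable m n) : GridTileable m n := by
  obtain ⟨N, corner, side, hside, hdisj, hunion⟩ := h
  obtain ⟨x, hx0, hx1, hx⟩ := exists_generic_offset fun k => (corner k).1
  obtain ⟨y, hy0, hy1, hy⟩ := exists_generic_offset fun k => (corner k).2
  have hsub : ∀ k, closedSquare (corner k) (side k) ⊆ closedRect (0, 0) m n := fun k => by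
    rw [← hunion]; exact Set.subset_iUnion (fun i => closedSquare (corner i) (side i)) k
  have hlo : ∀ k, 0 ≤ (corner k).1 ∧ 0 ≤ (corner k).2 := fun k => by
    have := mem_closedRect.1 (hsub k (show corner k ∈ _ from mem_closedRect.2 (by simp)))
    exact ⟨this.1.1, this.2.1⟩
  have hhi : ∀ k, (corner k).1 + side k ≤ m ∧ (corner k).2 + side k ≤ n := fun k => by
    have := mem_closedRect.1 (hsub k (show ((corner k).1 + (side k : ℝ),
      (corner k).2 + (side k : ℝ)) ∈ _ from mem_closedRect.2 (by simp)))
    simpa using And.intro this.1.2 this.2.2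
  let block : Fin N → ℕ × ℕ × ℕ := fun k =>
    (⌈(corner k).1 - x⌉₊, ⌈(corner k).2 - y⌉₊, side k)
  have hblock : ∀ k i j, InBlock (block k) i j ↔
      (((corner k).1 ≤ i + x ∧ i + x < (corner k).1 + side k) ∧
        ((corner k).2 ≤ j + y ∧ j + y < (corner k).2 + side k)) := fun k i j =>
    and_congr (ceil_offset_le_and_lt (hlo k).1 hx1) (ceil_offset_le_and_lt (hlo k).2 hy1)
  have hint : ∀ k i j, InBlock (block k) i j →
      ((i + x, j + y) : ℝ × ℝ) ∈ interior (closedSquare (corner k) (side k)) := fun k i j hk => by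
    rw [hblock] at hk
    rw [interior_closedSquare]
    exact ⟨⟨lt_of_le_of_ne hk.1.1 (hx k i), hk.1.2⟩, ⟨lt_of_le_of_ne hk.2.1 (hy k j), hk.2.2⟩⟩
  refine ⟨Finset.univ.image block, ?_, fun i hi j hj => ?_⟩
  · simp only [Finset.mem_image, Finset.mem_univ, true_and, forall_exists_index,
      forall_apply_eq_imp_iff]
    exact fun k => ⟨hside k, ceil_offset_add_le hx0 (hlo k).1 (hhi k).1,
      ceil_offset_add_le hy0 (hlo k).2 (hhi k).2⟩
  · have hi' : (i : ℝ) + 1 ≤ m := by exact_mod_cast hi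
    have hj' : (j : ℝ) + 1 ≤ n := by exact_mod_cast hj
    have hmem : ((i + x, j + y) : ℝ × ℝ) ∈ ⋃ k, closedSquare (corner k) (side k) := by
      rw [hunion, mem_closedRect]
      have := Nat.cast_nonneg (α := ℝ) i
      have := Nat.cast_nonneg (α := ℝ) j
      refine ⟨⟨?_, ?_⟩, ?_, ?_⟩ <;> simp only <;> linarith
    obtain ⟨k, hk⟩ := Set.mem_iUnion.1 hmem
    have hk := mem_closedRect.1 hk
    -- Sides are integers, so a sample on the right edge would put the left edge on the shifted
    -- lattice too, or at a negative abscissa.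
    have hne1 : (i : ℝ) + x ≠ (corner k).1 + side k := fun h => by
      rcases le_or_gt (side k) i with h' | h'
      · exact hx k (i - side k) (by rw [Nat.cast_sub h']; linarith)
      · have : (i : ℝ) + 1 ≤ side k := by exact_mod_cast h'
        have := (hlo k).1
        linarith
    have hne2 : (j : ℝ) + y ≠ (corner k).2 + side k := fun h => by
      rcases le_or_gt (side k) j with h' | h'
      · exact hy k (j - side k) (by rw [Nat.cast_sub h']; linarith)
      · have : (j : ℝ) + 1 ≤ side k := by exact_mod_cast h'
        have := (hlo k).2
        linarith
    have hin : InBlock (block k) i j := (hblock k i j).2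
      ⟨⟨hk.1.1, lt_of_le_of_ne hk.1.2 hne1⟩, ⟨hk.2.1, lt_of_le_of_ne hk.2.2 hne2⟩⟩
    refine ⟨block k, ⟨Finset.mem_image_of_mem _ (Finset.mem_univ k), hin⟩, ?_⟩
    rintro _ ⟨hq, hqin⟩
    obtain ⟨l, -, rfl⟩ := Finset.mem_image.1 hq
    by_contra hne
    exact Set.disjoint_left.1 (hdisj l k fun h => hne (by rw [h])) (hint l i j hqin)
      (hint k i j hin)

/-- Every real number in `[0, m]` lies in one of the intervals `[i, i + 1]` with `i < m`. -/
theorem exists_cell {m : ℕ} (hm : 0 < m) {x : ℝ} (h0 : 0 ≤ x) (h1 : x ≤ m) :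
    ∃ i < m, (i : ℝ) ≤ x ∧ x ≤ i + 1 := by
  rcases h1.lt_or_eq with h | h
  · exact ⟨⌊x⌋₊, (Nat.floor_lt h0).2 h, Nat.floor_le h0, (Nat.lt_floor_add_one x).le⟩
  · refine ⟨m - 1, by omega, ?_, ?_⟩ <;> rw [Nat.cast_sub hm] <;> simp [h]

theorem exists_natCast_between {a b s t : ℕ} {x : ℝ} (h1 : (a : ℝ) < x) (h2 : x < a + s)
    (h3 : (b : ℝ) < x) (h4 : x < b + t) :
    ∃ i, (a ≤ i ∧ i < a + s) ∧ (b ≤ i ∧ i < b + t) := by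
  have hat : a < b + t := by exact_mod_cast h1.trans h4
  have hbs : b < a + s := by exact_mod_cast h3.trans h2
  have has : a < a + s := by exact_mod_cast h1.trans h2
  have hbt : b < b + t := by exact_mod_cast h3.trans h4
  exact ⟨max a b, by omega, by omega⟩

/-- Positivity matters: a board without cells has the empty tiling, whereas the degenerate closed
rectangle is nonempty. -/
theorem GridTileable.tileable {m n : ℕ} (hm : 0 < m) (hn : 0 < n) (h : GridTileable m n) :
    Tileable m n := by
  obtain ⟨S, hS, hcover⟩ := h
  let e : Fin S.card ≃ S := S.equivFin.symm
  refine ⟨S.card, fun k => ((e k).1.1, (e k).1.2.1), fun k => (e k).1.2.2,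
    fun k => (hS _ (e k).2).1, fun k l hkl => ?_, ?_⟩
  · refine Set.disjoint_left.2 fun z hk hl => hkl ?_
    rw [interior_closedSquare] at hk hl
    obtain ⟨i, hik, hil⟩ := exists_natCast_between hk.1.1 hk.1.2 hl.1.1 hl.1.2
    obtain ⟨j, hjk, hjl⟩ := exists_natCast_between hk.2.1 hk.2.2 hl.2.1 hl.2.2
    have hb := hS _ (e k).2
    simp only at hik hil hjk hjl
    have := (hcover i (by omega) j (by omega)).unique ⟨(e k).2, hik, hjk⟩ ⟨(e l).2, hil, hjl⟩
    exact e.injective (Subtype.ext this)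
  · refine Set.Subset.antisymm (Set.iUnion_subset fun k z hz => ?_) fun z hz => ?_
    · obtain ⟨-, h1, h2⟩ := hS _ (e k).2
      have h1 : ((e k).1.1 : ℝ) + (e k).1.2.2 ≤ m := by exact_mod_cast h1
      have h2 : ((e k).1.2.1 : ℝ) + (e k).1.2.2 ≤ n := by exact_mod_cast h2
      obtain ⟨⟨a, b⟩, c, d⟩ := mem_closedRect.1 hz
      have := Nat.cast_nonneg (α := ℝ) (e k).1.1
      have := Nat.cast_nonneg (α := ℝ) (e k).1.2.1
      simp only at a b c d
      refine mem_closedRect.2 ⟨⟨?_, ?_⟩, ?_, ?_⟩ <;> simp only <;> linarith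
    · obtain ⟨⟨a, b⟩, c, d⟩ := mem_closedRect.1 hz
      simp only [zero_add] at a b c d
      obtain ⟨i, hi, hi1, hi2⟩ := exists_cell hm a b
      obtain ⟨j, hj, hj1, hj2⟩ := exists_cell hn c d
      obtain ⟨q, ⟨hq, ⟨h1, h2⟩, h3, h4⟩, -⟩ := hcover i hi j hj
      refine Set.mem_iUnion.2 ⟨e.symm ⟨q, hq⟩, mem_closedRect.2 ?_⟩
      have h1 : (q.1 : ℝ) ≤ i := by exact_mod_cast h1
      have h2 : (i : ℝ) + 1 ≤ q.1 + q.2.2 := by exact_mod_cast h2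
      have h3 : (q.2.1 : ℝ) ≤ j := by exact_mod_cast h3
      have h4 : (j : ℝ) + 1 ≤ q.2.1 + q.2.2 := by exact_mod_cast h4
      simp only [Equiv.apply_symm_apply]
      refine ⟨⟨?_, ?_⟩, ?_, ?_⟩ <;> linarith

/-! ### Transposing and gluing boards -/

theorem IsGridTiling.symm {S : Finset (ℕ × ℕ × ℕ)} {m n : ℕ} (h : IsGridTiling S m n) :
    IsGridTiling (S.image fun q => (q.2.1, q.1, q.2.2)) n m := by
  obtain ⟨hS, hcover⟩ := h
  refine ⟨?_, fun i hi j hj => ?_⟩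
  · simp only [Finset.mem_image, forall_exists_index, and_imp, forall_apply_eq_imp_iff₂]
    exact fun q hq => ⟨(hS q hq).1, (hS q hq).2.2, (hS q hq).2.1⟩
  · obtain ⟨q, ⟨hq, hin⟩, huniq⟩ := hcover j hj i hi
    refine ⟨(q.2.1, q.1, q.2.2), ⟨Finset.mem_image_of_mem _ hq, hin.2, hin.1⟩, ?_⟩
    rintro _ ⟨hr, hrin⟩
    obtain ⟨r, hr', rfl⟩ := Finset.mem_image.1 hr
    rw [huniq r ⟨hr', hrin.2, hrin.1⟩]

theorem GridTileable.symm {m n : ℕ} (h : GridTileable m n) : GridTileable n m :=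
  let ⟨_, hS⟩ := h
  ⟨_, hS.symm⟩

theorem gridTileable_comm {m n : ℕ} : GridTileable m n ↔ GridTileable n m :=
  ⟨GridTileable.symm, GridTileable.symm⟩

theorem GridTileable.add_right {m n k : ℕ} (h₁ : GridTileable m n) (h₂ : GridTileable m k) :
    GridTileable m (n + k) := by
  obtain ⟨S, hS, hcS⟩ := h₁
  obtain ⟨T, hT, hcT⟩ := h₂
  refine ⟨S ∪ T.image fun q => (q.1, n + q.2.1, q.2.2), ?_, fun i hi j hj => ?_⟩
  · intro q hq
    rcases Finset.mem_union.1 hq with hq | hq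
    · have := hS q hq; omega
    · obtain ⟨q, hq', rfl⟩ := Finset.mem_image.1 hq
      have := hT q hq'; simp only; omega
  · rcases lt_or_ge j n with hjn | hjn
    · obtain ⟨q, ⟨hq, hin⟩, huniq⟩ := hcS i hi j hjn
      refine ⟨q, ⟨Finset.mem_union_left _ hq, hin⟩, ?_⟩
      rintro r ⟨hr, hrin⟩
      rcases Finset.mem_union.1 hr with hr | hr
      · exact huniq r ⟨hr, hrin⟩
      · obtain ⟨r, hr, rfl⟩ := Finset.mem_image.1 hr
        simp only [InBlock] at hrin; omega
    · obtain ⟨q, ⟨hq, hin⟩, huniq⟩ := hcT i hi (j - n) (by omega)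
      refine ⟨(q.1, n + q.2.1, q.2.2),
        ⟨Finset.mem_union_right _ (Finset.mem_image_of_mem _ hq), ?_⟩, ?_⟩
      · simp only [InBlock] at hin ⊢; omega
      rintro r ⟨hr, hrin⟩
      rcases Finset.mem_union.1 hr with hr | hr
      · have := hS r hr
        simp only [InBlock] at hrin; omega
      · obtain ⟨r, hr', rfl⟩ := Finset.mem_image.1 hr
        rw [huniq r ⟨hr', by simp only [InBlock] at hrin ⊢; omega⟩]

theorem GridTileable.add_left {m k n : ℕ} (h₁ : GridTileable m n) (h₂ : GridTileable k n) :
    GridTileable (m + k) n :=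
  (h₁.symm.add_right h₂.symm).symm

theorem gridTileable_zero_right (m : ℕ) : GridTileable m 0 :=
  ⟨∅, by simp, by simp⟩

theorem GridTileable.mul_right {m n : ℕ} (h : GridTileable m n) (k : ℕ) :
    GridTileable m (n * k) := by
  induction k with
  | zero => exact gridTileable_zero_right m
  | succ k ih => exact ih.add_right h

theorem gridTileable_self {s : ℕ} (hs : 2 ≤ s) : GridTileable s s :=
  ⟨{(0, 0, s)}, by simp [hs], fun i hi j hj => ⟨(0, 0, s), by simp [InBlock, hi, hj], by simp⟩⟩

theorem GridTileable.of_dvd {s n : ℕ} (hs : 2 ≤ s) (h : s ∣ n) : GridTileable s n := by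
  obtain ⟨k, rfl⟩ := h
  exact (gridTileable_self hs).mul_right k

theorem gridTileable_six {n : ℕ} (hn : 2 ≤ n) : GridTileable 6 n := by
  have h2 : GridTileable 6 2 := (GridTileable.of_dvd le_rfl (by norm_num)).symm
  have h3 : GridTileable 6 3 := (GridTileable.of_dvd (by norm_num) (by norm_num)).symm
  rcases Nat.even_or_odd' n with ⟨k, rfl | rfl⟩
  · exact h2.mul_right k
  · obtain ⟨l, rfl⟩ : ∃ l, k = l + 1 := ⟨k - 1, by omega⟩
    exact (h2.mul_right l).add_right h3

/-- Either side of a tileable board may be lengthened by a multiple of `6`. -/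
theorem GridTileable.add_mul_six {m n : ℕ} (hm : 2 ≤ m) (hn : 2 ≤ n) (h : GridTileable m n)
    (k l : ℕ) : GridTileable (m + 6 * k) (n + 6 * l) := by
  have h₁ : GridTileable (m + 6 * k) n := h.add_left ((gridTileable_six hn).symm.mul_right k).symm
  exact h₁.add_right ((gridTileable_six (by omega)).symm.mul_right l)

/-! ### Base boards and the positive cases -/

/-- A tiling of the `11 × 13` board, the only one needed that has no straight cut. -/
def elevenThirteenBlocks : Finset (ℕ × ℕ × ℕ) :=
  {(0, 0, 2), (2, 0, 2), (4, 0, 2), (6, 0, 2), (8, 0, 3), (0, 2, 2), (2, 2, 2), (4, 2, 2),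
    (6, 2, 2), (8, 3, 3), (0, 4, 3), (3, 4, 5), (8, 6, 3), (0, 7, 3), (3, 9, 2), (5, 9, 2),
    (7, 9, 2), (9, 9, 2), (0, 10, 3), (3, 11, 2), (5, 11, 2), (7, 11, 2), (9, 11, 2)}

theorem gridTileable_eleven_thirteen : GridTileable 11 13 := by
  have hcard : ∀ i < 11, ∀ j < 13,
      (elevenThirteenBlocks.filter fun q => InBlock q i j).card = 1 := by decide +kernel
  refine ⟨elevenThirteenBlocks, by decide +kernel, fun i hi j hj => ?_⟩
  obtain ⟨q, hq⟩ := Finset.card_eq_one.1 (hcard i hi j hj)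
  refine ⟨q, ?_, fun r hr => ?_⟩
  · exact Finset.mem_filter.1 (hq ▸ Finset.mem_singleton_self q)
  · exact Finset.mem_singleton.1 (hq ▸ Finset.mem_filter.2 hr)

/-- Side lengths of tileable boards, up to order and multiples of `6`. -/
def baseBoards : List (ℕ × ℕ) :=
  [(2, 2), (2, 4), (2, 6), (3, 3), (3, 6), (4, 4), (4, 6), (5, 5), (5, 6), (5, 10), (5, 15),
    (5, 20), (5, 25), (6, 6), (6, 7), (7, 7), (7, 10), (7, 14), (7, 17), (7, 21), (8, 15),
    (8, 17), (8, 19), (9, 10), (9, 13), (9, 14), (9, 17), (11, 13), (11, 14)]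

theorem gridTileable_of_mem_baseBoards {p : ℕ × ℕ} (hp : p ∈ baseBoards) :
    GridTileable p.1 p.2 := by
  have self := @gridTileable_self
  have six := @gridTileable_six
  have mul : ∀ {s n : ℕ}, 2 ≤ s → s ∣ n → GridTileable s n := GridTileable.of_dvd
  have h2 : ∀ {n : ℕ}, 2 ∣ n → GridTileable 2 n := mul le_rfl
  have h3 : ∀ {n : ℕ}, 3 ∣ n → GridTileable 3 n := mul (by norm_num)
  have h4_10 : GridTileable 4 10 := (h2 (by norm_num)).add_left (h2 (by norm_num))
  have h5_10 : GridTileable 5 10 := mul (by norm_num) (by norm_num)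
  have h7_10 : GridTileable 7 10 := h5_10.add_left (h2 (by norm_num))
  have h9_10 : GridTileable 9 10 := h4_10.add_left h5_10
  have h5_15 : GridTileable 5 15 := mul (by norm_num) (by norm_num)
  have h7_14 : GridTileable 7 14 := mul (by norm_num) (by norm_num)
  have h8_4 : GridTileable 8 4 := (mul (by norm_num) (by norm_num)).symm
  have h8_15 : GridTileable 8 15 := (h3 (by norm_num)).add_left h5_15
  have h9_14 : GridTileable 9 14 := (h2 (by norm_num)).add_left h7_14
  have h4_14 : GridTileable 4 14 := (h2 (by norm_num)).add_left (h2 (by norm_num))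
  simp only [baseBoards, List.mem_cons, List.not_mem_nil, or_false] at hp
  rcases hp with rfl | rfl | rfl | rfl | rfl | rfl | rfl | rfl | rfl | rfl | rfl | rfl | rfl | rfl |
    rfl | rfl | rfl | rfl | rfl | rfl | rfl | rfl | rfl | rfl | rfl | rfl | rfl | rfl | rfl
  · exact h2 (by norm_num)
  · exact h2 (by norm_num)
  · exact h2 (by norm_num)
  · exact h3 (by norm_num)
  · exact h3 (by norm_num)
  · exact mul (by norm_num) (by norm_num)
  · exact (six (by norm_num)).symm
  · exact mul (by norm_num) (by norm_num)
  · exact (six (by norm_num)).symm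
  · exact h5_10
  · exact h5_15
  · exact mul (by norm_num) (by norm_num)
  · exact mul (by norm_num) (by norm_num)
  · exact six (by norm_num)
  · exact six (by norm_num)
  · exact mul (by norm_num) (by norm_num)
  · exact h7_10
  · exact h7_14
  · exact (self (by norm_num)).add_right h7_10
  · exact mul (by norm_num) (by norm_num)
  · exact h8_15
  · exact (GridTileable.symm (h2 (by norm_num))).add_right h8_15
  · exact h8_4.add_right h8_15
  · exact h9_10
  · exact (GridTileable.symm (h3 (by norm_num))).add_right h9_10
  · exact h9_14
  · exact (GridTileable.symm (h3 (by norm_num))).add_right h9_14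
  · exact gridTileable_eleven_thirteen
  · exact h4_14.add_left h7_14

/-- The board is a base board with its sides lengthened by multiples of `6`. -/
def extendsBaseBoard (m n : ℕ) : Bool :=
  baseBoards.any fun p =>
    (Nat.ble p.1 m && (m - p.1) % 6 == 0 && Nat.ble p.2 n && (n - p.2) % 6 == 0) ||
    (Nat.ble p.1 n && (n - p.1) % 6 == 0 && Nat.ble p.2 m && (m - p.2) % 6 == 0)

theorem gridTileable_of_extends {a b m n : ℕ} (hab : (a, b) ∈ baseBoards) (ha : a ≤ m)
    (hb : b ≤ n) (ha6 : (m - a) % 6 = 0) (hb6 : (n - b) % 6 = 0) : GridTileable m n := by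
  have hside : ∀ p ∈ baseBoards, 2 ≤ p.1 ∧ 2 ≤ p.2 := by decide
  have := (gridTileable_of_mem_baseBoards hab).add_mul_six (hside _ hab).1 (hside _ hab).2
    ((m - a) / 6) ((n - b) / 6)
  convert this using 1 <;> simp only <;> omega

theorem gridTileable_of_extendsBaseBoard {m n : ℕ} (h : extendsBaseBoard m n = true) :
    GridTileable m n := by
  simp only [extendsBaseBoard, List.any_eq_true, Bool.or_eq_true, Bool.and_eq_true,
    Nat.ble_eq, beq_iff_eq] at h
  obtain ⟨⟨a, b⟩, hab, ⟨⟨⟨h1, h2⟩, h3⟩, h4⟩ | ⟨⟨⟨h1, h2⟩, h3⟩, h4⟩⟩ := h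
  · exact gridTileable_of_extends hab h1 h3 h2 h4
  · exact (gridTileable_of_extends hab h1 h3 h2 h4).symm

theorem gridTileable_of_five_le_of_twenty_le {m n : ℕ} (hm : 5 ≤ m) (hn : 20 ≤ n) :
    GridTileable m n := by
  -- One full period modulo 6 in each direction, starting at the thresholds 5 and 20, suffices.
  have hbase : ∀ a < 6, ∀ b < 6, extendsBaseBoard (5 + a) (20 + b) = true := by decide +kernel
  have := (gridTileable_of_extendsBaseBoard (hbase ((m - 5) % 6) (Nat.mod_lt _ (by norm_num))
    ((n - 20) % 6) (Nat.mod_lt _ (by norm_num)))).add_mul_six (by omega) (by omega)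
    ((m - 5) / 6) ((n - 20) / 6)
  convert this using 1 <;> omega

theorem gridTileable_of_mem_tableRow {m n : ℕ} (h : n ∈ tableRow m) : GridTileable m n := by
  have hbase : ∀ m < 20, ∀ n ∈ tableRow m, extendsBaseBoard m n = true := by decide +kernel
  rcases lt_or_ge m 20 with hm | hm
  · exact gridTileable_of_extendsBaseBoard (hbase m hm n h)
  · have : tableRow m = ∅ := by
      unfold tableRow
      split <;> first | omega | rfl
    simp [this] at h

/-! ### Line sums and divisibility obstructions -/

/-- The sides of the blocks met by a line of cells add up to its length. -/
theorem IsGridTiling.sum_side_of_line {m n : ℕ} {S : Finset (ℕ × ℕ × ℕ)}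
    (h : IsGridTiling S m n) {i : ℕ} (hi : i < m) :
    ∑ q ∈ S with q.1 ≤ i ∧ i < q.1 + q.2.2, q.2.2 = n := by
  obtain ⟨hS, hcover⟩ := h
  have hone : ∀ j ∈ Finset.range n, (S.filter fun q => InBlock q i j).card = 1 := fun j hj => by
    obtain ⟨q, hq, huniq⟩ := hcover i hi j (Finset.mem_range.1 hj)
    refine Finset.card_eq_one.2 ⟨q, Finset.ext fun r => ?_⟩
    rw [Finset.mem_filter, Finset.mem_singleton]
    exact ⟨huniq r, fun h => h ▸ hq⟩
  -- Incidences between blocks and the cells of the line are counted in two ways.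
  calc ∑ q ∈ S with q.1 ≤ i ∧ i < q.1 + q.2.2, q.2.2
      = ∑ q ∈ S, ((Finset.range n).filter fun j => InBlock q i j).card := by
        rw [Finset.sum_filter]
        refine Finset.sum_congr rfl fun q hq => ?_
        split_ifs with h
        · have : ((Finset.range n).filter fun j => InBlock q i j)
              = Finset.Ico q.2.1 (q.2.1 + q.2.2) := by
            ext j
            have := hS q hq
            rw [Finset.mem_filter, Finset.mem_range, Finset.mem_Ico, InBlock]
            omega
          rw [this, Nat.card_Ico, Nat.add_sub_cancel_left]
        · rw [eq_comm, Finset.card_eq_zero, Finset.filter_eq_empty_iff]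
          exact fun j _ hj => h hj.1
    _ = ∑ j ∈ Finset.range n, (S.filter fun q => InBlock q i j).card :=
        Finset.sum_card_bipartiteAbove_eq_sum_card_bipartiteBelow fun q j => InBlock q i j
    _ = n := by rw [Finset.sum_congr rfl hone]; simp

/-- On a line through the block, whatever it leaves uncovered is filled by blocks of side at least
2, so a gap of exactly 1 is impossible. -/
theorem IsGridTiling.side_eq_or_add_two_le {m n : ℕ} {S : Finset (ℕ × ℕ × ℕ)}
    (h : IsGridTiling S m n) {q : ℕ × ℕ × ℕ} (hq : q ∈ S) : q.2.2 = n ∨ q.2.2 + 2 ≤ n := by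
  have hq' := h.1 q hq
  have hsum := h.sum_side_of_line (i := q.1) (by omega)
  have hmem : q ∈ S.filter fun r => r.1 ≤ q.1 ∧ q.1 < r.1 + r.2.2 :=
    Finset.mem_filter.2 ⟨hq, le_rfl, by omega⟩
  rw [← Finset.add_sum_erase _ _ hmem] at hsum
  rcases Finset.eq_empty_or_nonempty
    ((S.filter fun r => r.1 ≤ q.1 ∧ q.1 < r.1 + r.2.2).erase q) with he | ⟨r, hr⟩
  · rw [he, Finset.sum_empty] at hsum
    exact Or.inl hsum
  · have hle := Finset.single_le_sum (f := fun p : ℕ × ℕ × ℕ => p.2.2)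
      (fun _ _ => Nat.zero_le _) hr
    have hr2 := (h.1 r (Finset.mem_filter.1 (Finset.mem_of_mem_erase hr)).1).1
    exact Or.inr (by omega)

/-- If `d` divides the side of every block that may occur on a board of width `m`, then `d`
divides its length. -/
theorem GridTileable.dvd_of_forall_side {m n d : ℕ} (hm : 0 < m) (h : GridTileable m n)
    (hd : ∀ s, 2 ≤ s → s = m ∨ s + 2 ≤ m → d ∣ s) : d ∣ n := by
  obtain ⟨S, hS⟩ := h
  rw [← hS.sum_side_of_line hm]
  refine Finset.dvd_sum fun q hq => hd _ (hS.1 q (Finset.mem_filter.1 hq).1).1 ?_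
  exact hS.symm.side_eq_or_add_two_le (q := (q.2.1, q.1, q.2.2))
    (Finset.mem_image_of_mem _ (Finset.mem_filter.1 hq).1)

theorem gridTileable_two_iff {n : ℕ} : GridTileable 2 n ↔ 2 ∣ n :=
  ⟨fun h => h.dvd_of_forall_side (by norm_num) (by omega), .of_dvd le_rfl⟩

theorem gridTileable_three_iff {n : ℕ} : GridTileable 3 n ↔ 3 ∣ n :=
  ⟨fun h => h.dvd_of_forall_side (by norm_num) (by omega), .of_dvd (by norm_num)⟩

/-- A block of side 3 would leave a gap of 1 across the width, so only sides 2 and 4 occur. -/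
theorem gridTileable_four_iff {n : ℕ} : GridTileable 4 n ↔ 2 ∣ n :=
  ⟨fun h => h.dvd_of_forall_side (by norm_num) (by omega),
    fun h => (gridTileable_two_iff.2 h).add_left (gridTileable_two_iff.2 h)⟩

/-! ### Exhaustive search on bit masks -/

/-- The number whose binary digits below position `k` are given by `P`. -/
def bitMask (P : ℕ → Bool) : ℕ → ℕ
  | 0 => 0
  | k + 1 => Nat.lor (bitMask P k) (bif P k then Nat.shiftLeft 1 k else 0)

theorem testBit_bitMask (P : ℕ → Bool) (k i : ℕ) :
    (bitMask P k).testBit i = true ↔ i < k ∧ P i = true := by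
  induction k with
  | zero => simp [bitMask]
  | succ k ih =>
    have : bitMask P (k + 1) = bitMask P k ||| (bif P k then 1 <<< k else 0) := rfl
    rw [this, Nat.testBit_or, Bool.or_eq_true, ih]
    cases hP : P k <;> simp only [cond_true, cond_false, Nat.zero_testBit, Nat.one_shiftLeft,
      Nat.testBit_two_pow, decide_eq_true_eq]
    · constructor
      · rintro (h | h)
        · exact ⟨by omega, h.2⟩
        · cases h
      · rintro ⟨h1, h2⟩
        exact Or.inl ⟨by have : i ≠ k := by rintro rfl; simp [hP] at h2
                         omega, h2⟩
    · constructor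
      · rintro (h | rfl)
        · exact ⟨by omega, h.2⟩
        · exact ⟨by omega, hP⟩
      · rintro ⟨h1, h2⟩
        rcases Nat.lt_succ_iff_lt_or_eq.1 h1 with h | h
        · exact Or.inl ⟨h, h2⟩
        · exact Or.inr h.symm

/-- The cells of an `s × s` block, for the row-by-row numbering of cells with rows of
length `w + 1`. -/
def blockMask (w s : ℕ) : ℕ :=
  bitMask (fun i => Nat.blt (i % (w + 1)) s && Nat.blt (i / (w + 1)) s) ((w + 1) * s)

/-- The cells next to a `w × n` board, in the numbering of `blockMask`: the last cell of each
row, and `w + 1` additional rows. -/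
def borderMask (w n : ℕ) : ℕ :=
  bitMask (fun i => Nat.beq (i % (w + 1)) w || Nat.ble n (i / (w + 1))) ((n + w + 1) * (w + 1))

/-- Adds one of the blocks `L` to the occupied cells `M` so that `f` accepts the result, going
through `L` until a block does not fit. -/
def tryBlocks (f : ℕ → Bool) (M : ℕ) (L : List ℕ) : Bool :=
  List.rec false (fun b _ ih =>
    Bool.rec false (Bool.rec ih true (f (Nat.lor M b))) (Nat.beq (Nat.land M b) 0)) L

/-- Tries to occupy the `k` cells following the current one, given the occupied cells `M`
(numbered relative to the current cell), always covering the first free cell. -/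
def canFill (L : List ℕ) (k : ℕ) : ℕ → Bool :=
  Nat.rec (fun _ => true) (fun _ ih M =>
    Bool.rec (tryBlocks (fun N => ih (Nat.shiftRight N 1)) M L) (ih (Nat.shiftRight M 1))
      (Nat.beq (Nat.land M 1) 1)) k

/-- Exhaustive search for a tiling of the `w × n` board. -/
def searchTiling (w n : ℕ) : Bool :=
  -- The candidate sides are `2, …, w + 1`; the last never fits, since it meets the border column.
  canFill ((List.range' 2 w).map (blockMask w)) (n * (w + 1)) (borderMask w n)

theorem testBit_blockMask {w s i : ℕ} :
    (blockMask w s).testBit i = true ↔ i % (w + 1) < s ∧ i / (w + 1) < s := by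
  rw [blockMask, testBit_bitMask, Bool.and_eq_true, Nat.blt_eq, Nat.blt_eq]
  exact and_iff_right_of_imp fun h => by
    rw [mul_comm]; exact (Nat.div_lt_iff_lt_mul (Nat.succ_pos w)).1 h.2

/-- Stopping at the first misfit loses nothing: if the block of side `s` fits, so do the smaller
ones tried before it. -/
theorem tryBlocks_range {f : ℕ → Bool} {M : ℕ} {b : ℕ → ℕ} {s : ℕ} (hf : f (M ||| b s) = true)
    (hfit : ∀ t ≤ s, M &&& b t = 0) (l a : ℕ) (ha : a ≤ s) (hl : s < a + l) :
    tryBlocks f M ((List.range' a l).map b) = true := by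
  induction l generalizing a with
  | zero => omega
  | succ l ih =>
    have h0 : Nat.beq (Nat.land M (b a)) 0 = true := Nat.beq_eq ▸ hfit a ha
    have : tryBlocks f M ((List.range' a (l + 1)).map b) =
        Bool.rec false (Bool.rec (tryBlocks f M ((List.range' (a + 1) l).map b)) true
          (f (M ||| b a))) (Nat.beq (Nat.land M (b a)) 0) := rfl
    rw [this, h0]
    cases hfa : f (M ||| b a)
    · have : a ≠ s := by rintro rfl; simp [hf] at hfa
      exact ih (a + 1) (by omega) (by omega)
    · rfl

theorem canFill_succ_of_testBit {L : List ℕ} {k M : ℕ} (h : M.testBit 0 = true) :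
    canFill L (k + 1) M = canFill L k (M >>> 1) := by
  have h1 : Nat.beq (Nat.land M 1) 1 = true := by
    rw [Nat.testBit_zero, decide_eq_true_eq] at h
    exact Nat.beq_eq ▸ (Nat.and_one_is_mod M).trans h
  have : canFill L (k + 1) M = Bool.rec (tryBlocks (fun N => canFill L k (N >>> 1)) M L)
    (canFill L k (M >>> 1)) (Nat.beq (Nat.land M 1) 1) := rfl
  rw [this, h1]

theorem canFill_succ_of_not_testBit {L : List ℕ} {k M : ℕ} (h : ¬ M.testBit 0 = true) :
    canFill L (k + 1) M = tryBlocks (fun N => canFill L k (N >>> 1)) M L := by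
  have h1 : Nat.beq (Nat.land M 1) 1 = false := by
    rw [← Bool.not_eq_true, Nat.beq_eq]
    exact fun h1 => h (by rw [Nat.testBit_zero, decide_eq_true_eq, ← Nat.and_one_is_mod]; exact h1)
  have : canFill L (k + 1) M = Bool.rec (tryBlocks (fun N => canFill L k (N >>> 1)) M L)
    (canFill L k (M >>> 1)) (Nat.beq (Nat.land M 1) 1) := rfl
  rw [this, h1]

/-- The number of the lower left cell of a block, for rows of length `w + 1`. -/
def blockPos (w : ℕ) (q : ℕ × ℕ × ℕ) : ℕ :=
  q.2.1 * (w + 1) + q.1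

/-- Cell number `j` lies in the block `q`. -/
def CellMem (w : ℕ) (j : ℕ) (q : ℕ × ℕ × ℕ) : Prop :=
  InBlock q (j % (w + 1)) (j / (w + 1))

/-- The block avoids the extra column `w`, so adding an offset to its position never carries into
the next row. -/
theorem cellMem_blockPos_add {w i : ℕ} {q : ℕ × ℕ × ℕ} (hq : q.1 + q.2.2 ≤ w) :
    CellMem w (blockPos w q + i) q ↔ (blockMask w q.2.2).testBit i = true := by
  rw [testBit_blockMask]
  obtain ⟨x, y, s⟩ := q
  simp only [CellMem, InBlock, blockPos] at hq ⊢
  have hW : 0 < w + 1 := Nat.succ_pos w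
  constructor
  · rintro ⟨⟨h1, h2⟩, h3, h4⟩
    have hj := Nat.div_add_mod (y * (w + 1) + x + i) (w + 1)
    set a := (y * (w + 1) + x + i) % (w + 1)
    set b := (y * (w + 1) + x + i) / (w + 1)
    obtain ⟨c, hc⟩ := Nat.exists_eq_add_of_le h1
    obtain ⟨d, hd⟩ := Nat.exists_eq_add_of_le h3
    rw [hc] at h2
    rw [hd] at h4
    rw [hc, hd] at hj
    have hi : i = c + (w + 1) * d := by nlinarith
    rw [hi, Nat.add_mul_mod_self_left, Nat.add_mul_div_left _ _ hW, Nat.mod_eq_of_lt (by omega),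
      Nat.div_eq_of_lt (by omega)]
    omega
  · rintro ⟨h1, h2⟩
    have hi := Nat.div_add_mod i (w + 1)
    generalize i % (w + 1) = c at *
    generalize i / (w + 1) = d at *
    have hj : y * (w + 1) + x + i = (x + c) + (w + 1) * (y + d) := by rw [← hi]; ring
    rw [hj, Nat.add_mul_mod_self_left, Nat.add_mul_div_left _ _ hW, Nat.mod_eq_of_lt (by omega),
      Nat.div_eq_of_lt (by omega)]
    omega

/-- Cell number `j` is off the board, or in a block of `S` that starts before cell `p`. -/
def Occupied (S : Finset (ℕ × ℕ × ℕ)) (w n p j : ℕ) : Prop :=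
  ¬ (j % (w + 1) < w ∧ j / (w + 1) < n) ∨ ∃ q ∈ S, CellMem w j q ∧ blockPos w q < p

theorem Occupied.mono {S : Finset (ℕ × ℕ × ℕ)} {w n p p' j : ℕ} (h : Occupied S w n p j)
    (hp : p ≤ p') : Occupied S w n p' j :=
  h.imp id fun ⟨q, hq, hj, hlt⟩ => ⟨q, hq, hj, hlt.trans_le hp⟩

theorem IsGridTiling.eq_of_cellMem {S : Finset (ℕ × ℕ × ℕ)} {w n : ℕ} (h : IsGridTiling S w n)
    {j : ℕ} {q r : ℕ × ℕ × ℕ} (hq : q ∈ S) (hr : r ∈ S) (hjq : CellMem w j q)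
    (hjr : CellMem w j r) : q = r := by
  have := h.1 q hq
  have h1 := hjq.1
  have h2 := hjq.2
  exact (h.2 _ (by omega) _ (by omega)).unique ⟨hq, hjq⟩ ⟨hr, hjr⟩

theorem IsGridTiling.cellMem_blockPos {S : Finset (ℕ × ℕ × ℕ)} {w n : ℕ}
    (h : IsGridTiling S w n) {q : ℕ × ℕ × ℕ} (hq : q ∈ S) : CellMem w (blockPos w q) q := by
  have hq' := h.1 q hq
  rw [← Nat.add_zero (blockPos w q), cellMem_blockPos_add hq'.2.1, testBit_blockMask]
  simp only [Nat.zero_mod, Nat.zero_div]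
  omega

theorem IsGridTiling.not_occupied_of_cellMem {S : Finset (ℕ × ℕ × ℕ)} {w n : ℕ}
    (h : IsGridTiling S w n) {q : ℕ × ℕ × ℕ} (hq : q ∈ S) {j : ℕ} (hj : CellMem w j q) :
    ¬ Occupied S w n (blockPos w q) j := by
  rintro (hoff | ⟨r, hr, hjr, hlt⟩)
  · have hq' := h.1 q hq
    have h1 := hj.1
    have h2 := hj.2
    omega
  · rw [h.eq_of_cellMem hq hr hj hjr] at hlt
    exact lt_irrefl _ hlt

/-- A free cell before which all blocks have been placed is the first cell of its block. -/
theorem IsGridTiling.exists_blockPos_eq {S : Finset (ℕ × ℕ × ℕ)} {w n p : ℕ}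
    (h : IsGridTiling S w n) (hp : ¬ Occupied S w n p p) : ∃ q ∈ S, blockPos w q = p := by
  obtain ⟨hon, h3⟩ := not_or.1 hp
  obtain ⟨h1, h2⟩ := not_not.1 hon
  simp only [not_exists, not_and, not_lt] at h3
  obtain ⟨q, ⟨hq, hin⟩, -⟩ := h.2 _ h1 _ h2
  refine ⟨q, hq, le_antisymm ?_ (h3 q hq hin)⟩
  rw [← Nat.div_add_mod p (w + 1), mul_comm]
  exact Nat.add_le_add (Nat.mul_le_mul_right _ hin.2.1) hin.1.1

/-- The search can imitate `S`. The invariant is asymmetric: a false bit anywhere could block a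
block of `S`, while a missing bit matters only among the `k` cells still to be visited. -/
theorem IsGridTiling.canFill_eq_true {S : Finset (ℕ × ℕ × ℕ)} {w n : ℕ}
    (h : IsGridTiling S w n) (k p M : ℕ)
    (hM : ∀ i, M.testBit i = true → Occupied S w n p (p + i))
    (hM' : ∀ i < k, Occupied S w n p (p + i) → M.testBit i = true) :
    canFill ((List.range' 2 w).map (blockMask w)) k M = true := by
  induction k generalizing p M with
  | zero => rfl
  | succ k ih =>
    by_cases h0 : M.testBit 0 = true
    · rw [canFill_succ_of_testBit h0]
      refine ih (p + 1) _ (fun i hi => ?_) fun i hi hocc => ?_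
      · rw [Nat.testBit_shiftRight] at hi
        rw [add_assoc]
        exact (hM _ hi).mono (Nat.le_succ p)
      · rw [Nat.testBit_shiftRight]
        rw [add_assoc] at hocc
        refine hM' _ (by omega) ?_
        rcases hocc with hoff | ⟨q, hq, hmem, hlt⟩
        · exact Or.inl hoff
        rcases Nat.lt_succ_iff_lt_or_eq.1 hlt with hlt | heq
        · exact Or.inr ⟨q, hq, hmem, hlt⟩
        -- A block of `S` starting at `p` would leave `p` unoccupied so far, contrary to bit 0.
        · exact absurd (heq ▸ hM 0 h0)
            (h.not_occupied_of_cellMem hq (heq ▸ h.cellMem_blockPos hq))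
    · rw [canFill_succ_of_not_testBit h0]
      obtain ⟨q, hq, hpos⟩ := h.exists_blockPos_eq (fun hp => h0 (hM' 0 (by omega) hp))
      have hq' := h.1 q hq
      have hbit : ∀ i, CellMem w (p + i) q ↔ (blockMask w q.2.2).testBit i = true :=
        fun i => hpos ▸ cellMem_blockPos_add hq'.2.1
      refine tryBlocks_range (s := q.2.2) ?_ (fun t ht => ?_) _ _ hq'.1 (by omega)
      · refine ih (p + 1) _ (fun i hi => ?_) fun i hi hocc => ?_
        · rw [Nat.testBit_shiftRight, Nat.testBit_or, Bool.or_eq_true] at hi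
          rw [add_assoc]
          rcases hi with hi | hi
          · exact (hM _ hi).mono (Nat.le_succ p)
          · exact Or.inr ⟨q, hq, (hbit _).2 hi, by omega⟩
        · rw [Nat.testBit_shiftRight, Nat.testBit_or, Bool.or_eq_true]
          rw [add_assoc] at hocc
          rcases hocc with hoff | ⟨r, hr, hmem, hlt⟩
          · exact Or.inl (hM' _ (by omega) (Or.inl hoff))
          rcases Nat.lt_succ_iff_lt_or_eq.1 hlt with hlt | heq
          · exact Or.inl (hM' _ (by omega) (Or.inr ⟨r, hr, hmem, hlt⟩))
          · have hrq : r = q := h.eq_of_cellMem hr hq (h.cellMem_blockPos hr)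
              (by rw [heq, ← hpos]; exact h.cellMem_blockPos hq)
            exact Or.inr ((hbit _).1 (hrq ▸ hmem))
      -- A `t × t` block at `p` with `t ≤ s` lies inside `q`, whose cells are all still free.
      · refine Nat.zero_of_testBit_eq_false fun i => ?_
        rw [Nat.testBit_and, ← Bool.not_eq_true, Bool.and_eq_true]
        rintro ⟨h1, h2⟩
        rw [testBit_blockMask] at h2
        have hmem := (hbit i).2 (testBit_blockMask.2 (by omega))
        exact h.not_occupied_of_cellMem hq hmem (hpos ▸ hM i h1)

theorem GridTileable.searchTiling_eq_true {w n : ℕ} (h : GridTileable w n) :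
    searchTiling w n = true := by
  obtain ⟨S, hS⟩ := h
  refine hS.canFill_eq_true _ 0 _ (fun i hi => Or.inl ?_) fun i hi hocc => ?_
  · rw [borderMask, testBit_bitMask, Bool.or_eq_true, Nat.beq_eq, Nat.ble_eq] at hi
    rw [zero_add]
    omega
  · rw [borderMask, testBit_bitMask, Bool.or_eq_true, Nat.beq_eq, Nat.ble_eq]
    have hi' : (n + w + 1) * (w + 1) = n * (w + 1) + (w + 1) * (w + 1) := by ring
    have := Nat.mod_lt i (Nat.add_one_pos w)
    rcases hocc with hoff | ⟨q, -, -, hlt⟩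
    · rw [zero_add] at hoff
      exact ⟨by omega, by omega⟩
    · omega

/-! ### Sporadic boards and assembly of the table -/

/-- Untileable boards with sides at least `5`, up to order, that only a search rules out. -/
def sporadicBoards : List (ℕ × ℕ) :=
  [(5, 7), (5, 8), (5, 9), (5, 13), (5, 14), (5, 19), (7, 8), (7, 9), (7, 11), (7, 15), (8, 9),
    (8, 11), (8, 13), (9, 11)]

theorem not_gridTileable_of_mem_sporadicBoards {m n : ℕ} (h : (m, n) ∈ sporadicBoards) :
    ¬ GridTileable m n := by
  have hsearch : ∀ p ∈ sporadicBoards, searchTiling p.1 p.2 = false := by decide +kernel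
  exact fun ht => Bool.false_ne_true ((hsearch _ h).symm.trans ht.searchTiling_eq_true)

theorem tileable_iff_gridTileable {m n : ℕ} (hm : 0 < m) (hn : 0 < n) :
    Tileable m n ↔ GridTileable m n :=
  ⟨Tileable.gridTileable, GridTileable.tileable hm hn⟩

theorem not_gridTileable_of_notMem_tableRow {m n : ℕ} (hm : 2 ≤ m) (hm' : m ≤ 19) (hn : 2 ≤ n)
    (hn' : n ≤ 19) (h : n ∉ tableRow m) : ¬ GridTileable m n := by
  -- Every blank entry is explained by divisibility along a side 2, 3 or 4, or is sporadic.
  have hcases : ∀ m ∈ Finset.Icc 2 19, ∀ n ∈ Finset.Icc 2 19, n ∉ tableRow m →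
      (m = 2 ∧ ¬ 2 ∣ n ∨ m = 3 ∧ ¬ 3 ∣ n ∨ m = 4 ∧ ¬ 2 ∣ n ∨
        n = 2 ∧ ¬ 2 ∣ m ∨ n = 3 ∧ ¬ 3 ∣ m ∨ n = 4 ∧ ¬ 2 ∣ m) ∨
      (m, n) ∈ sporadicBoards ∨ (n, m) ∈ sporadicBoards := by decide +kernel
  rcases hcases m (Finset.mem_Icc.2 ⟨hm, hm'⟩) n (Finset.mem_Icc.2 ⟨hn, hn'⟩) h with h | h | h
  · rcases h with ⟨rfl, h⟩ | ⟨rfl, h⟩ | ⟨rfl, h⟩ | ⟨rfl, h⟩ | ⟨rfl, h⟩ | ⟨rfl, h⟩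
    · rwa [gridTileable_two_iff]
    · rwa [gridTileable_three_iff]
    · rwa [gridTileable_four_iff]
    · rwa [gridTileable_comm, gridTileable_two_iff]
    · rwa [gridTileable_comm, gridTileable_three_iff]
    · rwa [gridTileable_comm, gridTileable_four_iff]
  · exact not_gridTileable_of_mem_sporadicBoards h
  · rw [gridTileable_comm]
    exact not_gridTileable_of_mem_sporadicBoards h

theorem gridTileable_iff_mem_tableRow {m n : ℕ} (hm : 2 ≤ m) (hm' : m ≤ 19) (hn : 2 ≤ n)
    (hn' : n ≤ 19) : GridTileable m n ↔ n ∈ tableRow m :=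
  ⟨fun h => by_contra fun h' => not_gridTileable_of_notMem_tableRow hm hm' hn hn' h' h,
    gridTileable_of_mem_tableRow⟩

theorem gridTileable_of_ten_le {m n : ℕ} (hm : 10 ≤ m) (hn : 10 ≤ n) : GridTileable m n := by
  have htable : ∀ a < 10, ∀ b < 10, 10 + b ∈ tableRow (10 + a) := by decide +kernel
  rcases le_or_gt 20 n with hn' | hn'
  · exact gridTileable_of_five_le_of_twenty_le (by omega) hn'
  rcases le_or_gt 20 m with hm' | hm'
  · exact (gridTileable_of_five_le_of_twenty_le (by omega) hm').symm
  have := htable (m - 10) (by omega) (n - 10) (by omega)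
  rw [Nat.add_sub_cancel' hm, Nat.add_sub_cancel' hn] at this
  exact gridTileable_of_mem_tableRow this

theorem mainTheorem2 :
    -- rectangles with a side of length 2 or 4
    (∀ n : ℕ, 1 ≤ n → (Tileable 2 n ↔ Even n) ∧ (Tileable n 2 ↔ Even n)) ∧
    (∀ n : ℕ, 1 ≤ n → (Tileable 4 n ↔ Even n) ∧ (Tileable n 4 ↔ Even n)) ∧
    -- rectangles with a side of length 3
    (∀ n : ℕ, 1 ≤ n → (Tileable 3 n ↔ n ≡ 0 [MOD 3]) ∧ (Tileable n 3 ↔ n ≡ 0 [MOD 3])) ∧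
    -- large rectangles
    (∀ m n : ℕ, 5 ≤ m → 20 ≤ n → Tileable m n ∧ Tileable n m) ∧
    -- small rectangles: the table, check marks and blank entries
    (∀ m n : ℕ, 2 ≤ m → m ≤ 19 → 2 ≤ n → n ≤ 19 → (Tileable m n ↔ n ∈ tableRow m)) ∧
    -- every rectangle with both sides at least 10
    (∀ m n : ℕ, 10 ≤ m → 10 ≤ n → Tileable m n) := by
  refine ⟨fun n hn => ?_, fun n hn => ?_, fun n hn => ?_, fun m n hm hn => ?_,
    fun m n hm hm' hn hn' => ?_, fun m n hm hn => ?_⟩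
  · rw [tileable_iff_gridTileable two_pos hn, tileable_iff_gridTileable hn two_pos,
      gridTileable_comm (m := n), gridTileable_two_iff, even_iff_two_dvd]
    exact ⟨Iff.rfl, Iff.rfl⟩
  · rw [tileable_iff_gridTileable four_pos hn, tileable_iff_gridTileable hn four_pos,
      gridTileable_comm (m := n), gridTileable_four_iff, even_iff_two_dvd]
    exact ⟨Iff.rfl, Iff.rfl⟩
  · rw [tileable_iff_gridTileable three_pos hn, tileable_iff_gridTileable hn three_pos,
      gridTileable_comm (m := n), gridTileable_three_iff, Nat.modEq_zero_iff_dvd]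
    exact ⟨Iff.rfl, Iff.rfl⟩
  · have h := gridTileable_of_five_le_of_twenty_le hm hn
    exact ⟨h.tileable (by omega) (by omega), h.symm.tileable (by omega) (by omega)⟩
  · rw [tileable_iff_gridTileable (by omega) (by omega),
      gridTileable_iff_mem_tableRow hm hm' hn hn']
  · exact (gridTileable_of_ten_le hm hn).tileable (by omega) (by omega)
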